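/- Let $p$ be a prime and $n\ge 1$. On $\mathbb{Q}_p^n$ put $\|x\|_p=\max_i|x_i|_p$ and $\xi\cdot x=\sum_i\xi_ix_i$, let $d^nx$ be the Haar measure for which $\mathbb{Z}_p^n$ has measure $1$, and let $\Psi(y)=\exp(2\pi i\{y\}_p)$, where $\{y\}_p$ is the fractional part of $y\in\mathbb{Q}_p$. Let $w:\mathbb{Q}_p^n\to[0,\infty)$ be continuous and radial (i.e. $w(y)$ depends only on $\|y\|_p$), with $w(y)=0$ if and only if $y=0$, and assume that there are constants $C_0,C_1>0$, $\alpha_1,\alpha_2>n$ and $\alpha_3\ge 0$ such that $$C_0\|y\|_p^{\alpha_1}\le w(y)\le C_1\|y\|_p^{\alpha_2}e^{\alpha_3\|y\|_p}\qquad\text{for all }y\in\mathbb{Q}_p^n.$$ Let $\kappa>0$ and define $$A_w(\xi)=\int_{\mathbb{Q}_p^n}\frac{1-\Psi(-y\cdot\xi)}{w(y)}\,d^ny,\qquad Z_t(x)=Z(x,t)=\int_{\mathbb{Q}_p^n}e^{-\kappa tA_w(\xi)}\,\Psi(x\cdot\xi)\,d^n\xi\qquad(x,\xi\in\mathbb{Q}_p^n,\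 t>0).$$ Then these integrals converge absolutely, and: (i) $Z(x,t)$ is real and $Z(x,t)\ge 0$ for all $t>0$ and $x\in\mathbb{Q}_p^n$; (ii) $\int_{\mathbb{Q}_p^n}Z(x,t)\,d^nx=1$ for all $t>0$; (iii) $Z_t$ is continuous and lies in $L^1(\mathbb{Q}_p^n)\cap L^2(\mathbb{Q}_p^n)$ for all $t>0$; (iv) $Z_t*Z_{t'}=Z_{t+t'}$ for all $t,t'>0$, where the convolution integral converges absolutely at every point; (v) $Z_t\to\delta$ in $S'(\mathbb{Q}_p^n)$ as $t\to0^+$, that is, $\int_{\mathbb{Q}_p^n}Z(x,t)\varphi(x)\,d^nx\to\varphi(0)$ for every locally constant function $\varphi:\mathbb{Q}_p^n\to\mathbb{C}$ with compact support. -/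

import Mathlib

open MeasureTheory Filter Topology

noncomputable section

namespace PadicHeat

variable {p : ℕ} [Fact p.Prime] {n : ℕ}

instance instMeasurableSpacePadic : MeasurableSpace ℚ_[p] := borel ℚ_[p]

instance instBorelSpacePadic : BorelSpace ℚ_[p] := ⟨rfl⟩

/-- The closed unit ball `ℤ_p^n` of `ℚ_p^n` (with the maximum norm), a compact neighbourhood
of the origin. -/
def unitBall (p : ℕ) [Fact p.Prime] (n : ℕ) :
    TopologicalSpace.PositiveCompacts (Fin n → ℚ_[p]) where
  carrier := Metric.closedBall 0 1
  isCompact' := isCompact_closedBall 0 1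
  interior_nonempty' :=
    ⟨0, Metric.ball_subset_interior_closedBall (Metric.mem_ball_self one_pos)⟩

/-- The Haar measure `dⁿx` on `ℚ_p^n`, normalized so that the unit ball has measure `1`. -/
def haar (p : ℕ) [Fact p.Prime] (n : ℕ) : Measure (Fin n → ℚ_[p]) :=
  Measure.addHaarMeasure (unitBall p n)

/-- `p ^ max (-ord x) 0 * x` is a `p`-adic integer. -/
theorem norm_shift_le_one (x : ℚ_[p]) :
    ‖(p : ℚ_[p]) ^ (-x.valuation).toNat * x‖ ≤ 1 := by
  have hp : (1 : ℝ) < p := by exact_mod_cast (Fact.out : p.Prime).one_lt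
  rcases eq_or_ne x 0 with rfl | hx
  · simp
  · rw [norm_mul, norm_pow, Padic.norm_p, Padic.norm_eq_zpow_neg_valuation hx, inv_pow,
      ← zpow_natCast, ← zpow_neg, ← zpow_add₀ (by positivity)]
    exact zpow_le_one_of_nonpos₀ hp.le (by have := Int.self_le_toNat (-x.valuation); omega)

/-- The fractional part `{x}_p`. With `k = max (-ord x) 0`, the number `p ^ k * x` is a `p`-adic
integer `∑ x_j p ^ j`, and `PadicInt.appr _ k` is the truncation `∑_{j < k} x_j p ^ j`
of its digit expansion. -/
def fracPart (x : ℚ_[p]) : ℚ :=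
  (PadicInt.appr ⟨(p : ℚ_[p]) ^ (-x.valuation).toNat * x, norm_shift_le_one x⟩
    (-x.valuation).toNat : ℚ) / (p : ℚ) ^ (-x.valuation).toNat

/-- The standard additive character `Ψ(y) = exp (2 π i {y}_p)` of `ℚ_p`. -/
def stdChar (y : ℚ_[p]) : ℂ :=
  Complex.exp (2 * Real.pi * Complex.I * (fracPart y : ℂ))

/-- The inverse Fourier transform of a function on `ℚ_p^n`. -/
def invFourier (f : (Fin n → ℚ_[p]) → ℂ) (x : Fin n → ℚ_[p]) : ℂ :=
  ∫ ξ, f ξ * stdChar (x ⬝ᵥ ξ) ∂(haar p n)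

/-- The integrand `(1 - Ψ(-y·ξ)) / w(y)` of the symbol. -/
def symbolIntegrand (w : (Fin n → ℚ_[p]) → ℝ) (ξ y : Fin n → ℚ_[p]) : ℂ :=
  (1 - stdChar (-(y ⬝ᵥ ξ))) / (w y : ℂ)

/-- The symbol `A_w(ξ) = ∫ (1 - Ψ(-y·ξ)) / w(y) dⁿy`. -/
def symbol (w : (Fin n → ℚ_[p]) → ℝ) (ξ : Fin n → ℚ_[p]) : ℂ :=
  ∫ y, symbolIntegrand w ξ y ∂(haar p n)

/-- The function `ξ ↦ exp (-κ t A_w(ξ))`. -/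
def expSymbol (w : (Fin n → ℚ_[p]) → ℝ) (κ t : ℝ) (ξ : Fin n → ℚ_[p]) : ℂ :=
  Complex.exp (-(κ : ℂ) * (t : ℂ) * symbol w ξ)

/-- The heat kernel `Z_t(x) = Z(x, t)`. -/
def heatKernel (w : (Fin n → ℚ_[p]) → ℝ) (κ t : ℝ) : (Fin n → ℚ_[p]) → ℂ :=
  invFourier (expSymbol w κ t)

/-- The space `S(ℚ_p^n)` of Bruhat-Schwartz functions: locally constant functions with
compact support. -/
def BruhatSchwartz (p : ℕ) [Fact p.Prime] (n : ℕ) : Submodule ℂ ((Fin n → ℚ_[p]) → ℂ) where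
  carrier := {φ | IsLocallyConstant φ ∧ HasCompactSupport φ}
  add_mem' := fun hf hg => ⟨hf.1.add hg.1, hf.2.add hg.2⟩
  zero_mem' := ⟨IsLocallyConstant.const 0, HasCompactSupport.zero⟩
  smul_mem' := fun c _ hf =>
    ⟨hf.1.comp (fun z => c • z), hf.2.comp_left (g := fun z => c • z) (smul_zero c)⟩

/-- The space `S'(ℚ_p^n)` of distributions: all linear functionals on `S(ℚ_p^n)`. -/
abbrev Distribution (p : ℕ) [Fact p.Prime] (n : ℕ) : Type :=
  Module.Dual ℂ (BruhatSchwartz p n)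

/-- The Dirac distribution at the origin. -/
def dirac (p : ℕ) [Fact p.Prime] (n : ℕ) : Distribution p n where
  toFun := fun φ => φ.1 0
  map_add' := fun _ _ => rfl
  map_smul' := fun _ _ => rfl

/-- `T` is the distribution `φ ↦ ∫ f φ` given by the locally integrable function `f`. -/
def IsGivenBy (T : Distribution p n) (f : (Fin n → ℚ_[p]) → ℂ) : Prop :=
  LocallyIntegrable f (haar p n) ∧
    ∀ φ : BruhatSchwartz p n, T φ = ∫ x, f x * φ.1 x ∂(haar p n)

/-- Convergence in `S'(ℚ_p^n)`, i.e. convergence against every test function. -/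
def TendstoDistribution {ι : Type*} (T : ι → Distribution p n) (l : Filter ι)
    (T₀ : Distribution p n) : Prop :=
  ∀ φ : BruhatSchwartz p n, Tendsto (fun i => T i φ) l (𝓝 (T₀ φ))

end PadicHeat

end

noncomputable section

namespace PadicHeat

variable {p : ℕ} [Fact p.Prime] {n : ℕ}

/-! ### The additive character of `ℚ_p` -/

section Character

/-! Since `Ψ` is trivial on `ℤ_p`, for `‖ξ‖ ≤ p^N` only `‖y‖ > p^(-N)` contributes to the symbol.
Let `J_N` be `1/w` cut off to that region, integrable because `α₁ > n`. Then on the ball `A_w` is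
the constant `∫ J_N` minus a Fourier transform of `J_N` (`symbol_eq_sub_invFourier`). Hence `A_w` is
finite and continuous, and `e^(-κtA_w)` is there a positive constant times the exponential of the
transform of a nonnegative function. Expanding the exponential, each term gives an iterated
convolution of `J_N` with the transform of a ball indicator, which is nonnegative; letting `N → ∞`
yields `Z ≥ 0` (`heatKernel_nonneg`).

The upper bound on `w` forces `Re A_w(ξ) ≥ c‖ξ‖^(α₂ - n)` for `‖ξ‖ > 1`
(`exists_rpow_le_re_symbol`), so `e^(-κtA_w)` is integrable and `Z_t` is continuous and bounded.

Fourier inversion is elementary because ball indicators transform into multiples of ball indicators: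
integrating `Z_t(y)Ψ(-y·ξ)` over the ball of radius `p^M` gives the average of `e^(-κtA_w)` over the
dual ball about `ξ` (`setIntegral_invFourier_mul_stdChar`). At `ξ = 0`, together with `Z ≥ 0`, this
gives integrability and total mass one; for general `ξ` it recovers `e^(-κtA_w)`, whence the
semigroup law. As `t → 0⁺` these averages at `0` tend to `1`, so all mass concentrates at the
origin, which is (v). -/

theorem prime_pos : (0 : ℝ) < p := by exact_mod_cast (Fact.out : p.Prime).pos

theorem one_lt_prime : (1 : ℝ) < p := by exact_mod_cast (Fact.out : p.Prime).one_lt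

theorem padic_prime_ne_zero : (p : ℚ_[p]) ≠ 0 := by
  exact_mod_cast (Fact.out : p.Prime).ne_zero

theorem exists_int_eq_of_norm_le_one {c : ℤ} {k : ℕ} (h : ‖(c : ℚ_[p]) / (p : ℚ_[p]) ^ k‖ ≤ 1) :
    ∃ m : ℤ, (c : ℚ) / (p : ℚ) ^ k = m := by
  have hp := prime_pos (p := p)
  rw [norm_div, norm_pow, Padic.norm_p, div_le_one (by positivity), inv_pow,
    ← zpow_natCast, ← zpow_neg, Padic.norm_int_le_pow_iff_dvd] at h
  obtain ⟨m, rfl⟩ := h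
  refine ⟨m, ?_⟩
  have : (p : ℚ) ≠ 0 := by exact_mod_cast (Fact.out : p.Prime).ne_zero
  push_cast
  field_simp

theorem exists_fracPart_eq (x : ℚ_[p]) :
    ∃ (c : ℤ) (k : ℕ), fracPart x = (c : ℚ) / (p : ℚ) ^ k ∧
      ‖x - (c : ℚ_[p]) / (p : ℚ_[p]) ^ k‖ ≤ 1 := by
  set k := (-x.valuation).toNat with hk
  set z : ℤ_[p] := ⟨(p : ℚ_[p]) ^ k * x, norm_shift_le_one x⟩ with hz
  refine ⟨(z.appr k : ℤ), k, by simp [fracPart, hz, hk], ?_⟩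
  have hp := prime_pos (p := p)
  have hp0 := padic_prime_ne_zero (p := p)
  have h := (PadicInt.norm_le_pow_iff_mem_span_pow _ _).2 (PadicInt.appr_spec k z)
  rw [← PadicInt.padic_norm_e_of_padicInt] at h
  have h2 : x - ((z.appr k : ℤ) : ℚ_[p]) / (p : ℚ_[p]) ^ k =
      ((z - (z.appr k : ℤ_[p]) : ℤ_[p]) : ℚ_[p]) / (p : ℚ_[p]) ^ k := by
    push_cast
    rw [hz]
    field_simp
  rw [h2, norm_div, norm_pow, Padic.norm_p, div_le_one (by positivity), inv_pow,
    ← zpow_natCast, ← zpow_neg]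
  exact h

/-- Two representatives of `x` modulo `ℤ_p` with `p`-power denominators differ by an element of
`ℤ[1/p] ∩ ℤ_p = ℤ`, invisible to the exponential. This frees later arguments from the digit
expansion. -/
theorem stdChar_eq_of_norm_sub_le {x : ℚ_[p]} {c : ℤ} {k : ℕ}
    (h : ‖x - (c : ℚ_[p]) / (p : ℚ_[p]) ^ k‖ ≤ 1) :
    stdChar x = Complex.exp (2 * Real.pi * Complex.I * (((c : ℚ) / (p : ℚ) ^ k : ℚ) : ℂ)) := by
  obtain ⟨a, l, ha, hal⟩ := exists_fracPart_eq x
  have hp0 := padic_prime_ne_zero (p := p)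
  have hpq : (p : ℚ) ≠ 0 := by exact_mod_cast (Fact.out : p.Prime).ne_zero
  have h1 : ‖((a * p ^ k - c * p ^ l : ℤ) : ℚ_[p]) / (p : ℚ_[p]) ^ (k + l)‖ ≤ 1 := by
    have : ((a * p ^ k - c * p ^ l : ℤ) : ℚ_[p]) / (p : ℚ_[p]) ^ (k + l) =
        (x - (c : ℚ_[p]) / (p : ℚ_[p]) ^ k) + -(x - (a : ℚ_[p]) / (p : ℚ_[p]) ^ l) := by
      push_cast
      field_simp
      ring
    rw [this]
    refine (IsUltrametricDist.norm_add_le_max _ _).trans (max_le h ?_)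
    rwa [norm_neg]
  obtain ⟨m, hm⟩ := exists_int_eq_of_norm_le_one h1
  have h2 : (a : ℚ) / (p : ℚ) ^ l = (c : ℚ) / (p : ℚ) ^ k + m := by
    rw [← hm]
    push_cast
    field_simp
    ring
  rw [stdChar, ha, h2, Complex.exp_eq_exp_iff_exists_int]
  exact ⟨m, by push_cast; ring⟩

theorem stdChar_add (x y : ℚ_[p]) : stdChar (x + y) = stdChar x * stdChar y := by
  obtain ⟨a, k, -, ha⟩ := exists_fracPart_eq x
  obtain ⟨b, l, -, hb⟩ := exists_fracPart_eq y
  have hp0 := padic_prime_ne_zero (p := p)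
  have hpc : (p : ℂ) ≠ 0 := by exact_mod_cast (Fact.out : p.Prime).ne_zero
  have h : ‖x + y - ((a * p ^ l + b * p ^ k : ℤ) : ℚ_[p]) / (p : ℚ_[p]) ^ (k + l)‖ ≤ 1 := by
    have : x + y - ((a * p ^ l + b * p ^ k : ℤ) : ℚ_[p]) / (p : ℚ_[p]) ^ (k + l) =
        (x - (a : ℚ_[p]) / (p : ℚ_[p]) ^ k) + (y - (b : ℚ_[p]) / (p : ℚ_[p]) ^ l) := by
      push_cast
      field_simp
      ring
    rw [this]
    exact (IsUltrametricDist.norm_add_le_max _ _).trans (max_le ha hb)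
  rw [stdChar_eq_of_norm_sub_le h, stdChar_eq_of_norm_sub_le ha, stdChar_eq_of_norm_sub_le hb,
    ← Complex.exp_add]
  congr 1
  push_cast
  field_simp
  ring

theorem stdChar_eq_one_of_norm_le {x : ℚ_[p]} (h : ‖x‖ ≤ 1) : stdChar x = 1 := by
  rw [stdChar_eq_of_norm_sub_le (c := 0) (k := 0) (by simpa using h)]
  simp

@[simp] theorem stdChar_zero : stdChar (0 : ℚ_[p]) = 1 :=
  stdChar_eq_one_of_norm_le (by simp)

@[simp] theorem norm_stdChar (x : ℚ_[p]) : ‖stdChar x‖ = 1 := by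
  rw [stdChar, show (2 * Real.pi * Complex.I * (fracPart x : ℂ)) =
    ((2 * Real.pi * (fracPart x : ℝ) : ℝ) : ℂ) * Complex.I by push_cast; ring]
  exact Complex.norm_exp_ofReal_mul_I _

/-- Nontriviality just outside `ℤ_p` makes the duality between balls exact. -/
theorem stdChar_inv_prime_ne_one : stdChar ((p : ℚ_[p])⁻¹) ≠ 1 := by
  rw [stdChar_eq_of_norm_sub_le (c := 1) (k := 1) (by simp), Ne, Complex.exp_eq_one_iff]
  rintro ⟨m, hm⟩
  have h2 : (2 * Real.pi * Complex.I : ℂ) ≠ 0 := Complex.two_pi_I_ne_zero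
  rw [mul_comm (m : ℂ)] at hm
  have h3 := mul_left_cancel₀ h2 hm
  have hpc : (p : ℂ) ≠ 0 := by exact_mod_cast (Fact.out : p.Prime).ne_zero
  push_cast at h3
  rw [pow_one, div_eq_iff hpc] at h3
  have h4 : (1 : ℤ) = m * p := by exact_mod_cast h3
  have h5 := Int.isUnit_iff.1 (IsUnit.of_mul_eq_one m (by rw [mul_comm, ← h4]) : IsUnit (p : ℤ))
  have := (Fact.out : p.Prime).one_lt
  omega

theorem continuous_stdChar : Continuous (stdChar : ℚ_[p] → ℂ) := by
  refine continuous_iff_continuousAt.2 fun x => ?_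
  refine (continuousAt_const (y := stdChar x)).congr ?_
  filter_upwards [Metric.closedBall_mem_nhds x one_pos] with y hy
  rw [show y = x + (y - x) by ring, stdChar_add, stdChar_eq_one_of_norm_le (x := y - x), mul_one]
  simpa [dist_eq_norm] using hy

end Character

/-! ### Volumes of balls -/

section Volume

instance isAddHaarMeasure_haar : (haar p n).IsAddHaarMeasure := by
  unfold haar; infer_instance

theorem dist_le_of_le {x y z : Fin n → ℚ_[p]} {r : ℝ} (h : dist x y ≤ r) (h' : dist y z ≤ r) :
    dist x z ≤ r :=
  (dist_triangle_max x y z).trans (max_le h h')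

theorem measure_closedBall_eq (x : Fin n → ℚ_[p]) (r : ℝ) :
    haar p n (Metric.closedBall x r) = haar p n (Metric.closedBall 0 r) := by
  have := measure_preimage_add (haar p n) (-x) (Metric.closedBall 0 r)
  rw [← this]
  congr 1
  ext y
  simp [dist_eq_norm, sub_eq_neg_add]

theorem exists_digit {r : ℤ} {x : ℚ_[p]} (hx : ‖x‖ ≤ (p : ℝ) ^ (r + 1)) :
    ∃ d : Fin p, ‖x - (d : ℕ) * (p : ℚ_[p]) ^ (-(r + 1))‖ ≤ (p : ℝ) ^ r := by
  have hp := prime_pos (p := p)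
  have hp0 := padic_prime_ne_zero (p := p)
  have h1 : ‖x * (p : ℚ_[p]) ^ (r + 1)‖ ≤ 1 := by
    rw [norm_mul, Padic.norm_p_zpow, zpow_neg]
    exact mul_inv_le_one_of_le₀ hx (by positivity)
  obtain ⟨d, hd, hd'⟩ := PadicInt.exists_mem_range (⟨_, h1⟩ : ℤ_[p])
  refine ⟨⟨d, hd⟩, ?_⟩
  rw [PadicInt.maximalIdeal_eq_span_p, ← pow_one (p : ℤ_[p]),
    ← PadicInt.norm_le_pow_iff_mem_span_pow, ← PadicInt.padic_norm_e_of_padicInt] at hd'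
  have h2 : x - d * (p : ℚ_[p]) ^ (-(r + 1)) =
      (x * (p : ℚ_[p]) ^ (r + 1) - d) * (p : ℚ_[p]) ^ (-(r + 1)) := by
    rw [sub_mul, mul_assoc, ← zpow_add₀ hp0]
    simp
  rw [h2, norm_mul, Padic.norm_p_zpow, neg_neg]
  push_cast at hd'
  refine (mul_le_mul_of_nonneg_right hd' (by positivity)).trans_eq ?_
  rw [← zpow_add₀ hp.ne']
  congr 1
  ring

theorem digit_eq {r : ℤ} {d e : Fin p}
    (h : ‖((d : ℕ) * (p : ℚ_[p]) ^ (-(r + 1)) - (e : ℕ) * (p : ℚ_[p]) ^ (-(r + 1)) : ℚ_[p])‖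
      ≤ (p : ℝ) ^ r) : d = e := by
  have hp := prime_pos (p := p)
  rw [← sub_mul, norm_mul, Padic.norm_p_zpow, neg_neg, ← le_div_iff₀ (by positivity),
    ← zpow_sub₀ hp.ne'] at h
  have h1 : ‖(((d : ℤ) - (e : ℤ) : ℤ) : ℚ_[p])‖ ≤ (p : ℝ) ^ (-((1 : ℕ) : ℤ)) := by
    push_cast
    rwa [sub_add_cancel_left] at h
  rw [Padic.norm_int_le_pow_iff_dvd, pow_one] at h1
  have := Int.eq_zero_of_abs_lt_dvd h1 (by rw [abs_lt]; omega)
  ext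
  omega

/-- The larger ball splits into `p^n` disjoint translates of the smaller one, indexed by the leading
digit of each coordinate. -/
theorem measure_closedBall_succ (r : ℤ) :
    haar p n (Metric.closedBall 0 ((p : ℝ) ^ (r + 1))) =
      (p : ENNReal) ^ n * haar p n (Metric.closedBall 0 ((p : ℝ) ^ r)) := by
  have hp := prime_pos (p := p)
  let c : (Fin n → Fin p) → Fin n → ℚ_[p] := fun d i => (d i : ℕ) * (p : ℚ_[p]) ^ (-(r + 1))
  have hc : ∀ d, ‖c d‖ ≤ (p : ℝ) ^ (r + 1) := fun d => by
    refine (pi_norm_le_iff_of_nonneg (by positivity)).2 fun i => ?_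
    rw [norm_mul, Padic.norm_p_zpow, neg_neg]
    refine mul_le_of_le_one_left (by positivity) ?_
    exact_mod_cast Padic.norm_int_le_one (p := p) (d i : ℕ)
  have hunion : Metric.closedBall (0 : Fin n → ℚ_[p]) ((p : ℝ) ^ (r + 1)) =
      ⋃ d, Metric.closedBall (c d) ((p : ℝ) ^ r) := by
    ext x
    simp only [Metric.mem_closedBall, Set.mem_iUnion]
    constructor
    · intro hx
      rw [dist_zero_right, pi_norm_le_iff_of_nonneg (by positivity)] at hx
      choose d hd using fun i => exists_digit (hx i)
      exact ⟨d, by rw [dist_eq_norm, pi_norm_le_iff_of_nonneg (by positivity)]; exact hd⟩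
    · rintro ⟨d, hd⟩
      refine dist_le_of_le (hd.trans ?_) (by simpa using hc d)
      exact zpow_le_zpow_right₀ one_lt_prime.le (by omega)
  rw [hunion, measure_iUnion]
  · simp only [measure_closedBall_eq (c _), tsum_fintype]
    simp
  · intro d e hde
    refine Set.disjoint_left.2 fun x hx hx' => hde (funext fun i => digit_eq (r := r) ?_)
    have := dist_le_of_le (dist_comm x (c d) ▸ hx : dist (c d) x ≤ _) hx'
    rw [dist_eq_norm, pi_norm_le_iff_of_nonneg (by positivity)] at this
    exact this i
  · exact fun d => Metric.isClosed_closedBall.measurableSet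

theorem measureReal_closedBall (x : Fin n → ℚ_[p]) (r : ℤ) :
    (haar p n).real (Metric.closedBall x ((p : ℝ) ^ r)) = ((p : ℝ) ^ r) ^ n := by
  have hp := prime_pos (p := p)
  have hs : ∀ r : ℤ, (haar p n).real (Metric.closedBall 0 ((p : ℝ) ^ (r + 1))) =
      (p : ℝ) ^ n * (haar p n).real (Metric.closedBall 0 ((p : ℝ) ^ r)) := fun r => by
    rw [measureReal_def, measureReal_def, measure_closedBall_succ]
    simp
  rw [measureReal_def, measure_closedBall_eq, ← measureReal_def]
  induction r with
  | zero =>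
    have : haar p n (Metric.closedBall 0 1) = 1 :=
      Measure.addHaarMeasure_self (K₀ := unitBall p n)
    simp [measureReal_def, this]
  | succ i ih => rw [hs, ih, zpow_add_one₀ hp.ne', mul_pow, mul_comm]
  | pred i ih =>
    have := hs (-(i : ℤ) - 1)
    rw [sub_add_cancel, ih] at this
    nth_rewrite 2 [zpow_sub_one₀ hp.ne']
    rw [mul_pow, this, mul_comm ((p : ℝ) ^ n), mul_assoc, ← mul_pow,
      mul_inv_cancel₀ hp.ne', one_pow, mul_one]

end Volume

/-! ### Characters integrated over balls -/

section Orthogonality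

theorem norm_dotProduct_le (x y : Fin n → ℚ_[p]) : ‖x ⬝ᵥ y‖ ≤ ‖x‖ * ‖y‖ := by
  refine IsUltrametricDist.norm_sum_le_of_forall_le_of_nonneg (by positivity) fun i _ => ?_
  rw [norm_mul]
  exact mul_le_mul (norm_le_pi_norm x i) (norm_le_pi_norm y i) (norm_nonneg _) (norm_nonneg _)

@[fun_prop]
theorem continuous_dotProduct {X : Type*} [TopologicalSpace X] {f g : X → Fin n → ℚ_[p]}
    (hf : Continuous f) (hg : Continuous g) : Continuous fun x => f x ⬝ᵥ g x := by
  unfold dotProduct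
  fun_prop

@[fun_prop]
theorem continuous_stdChar_comp {X : Type*} [TopologicalSpace X] {f : X → ℚ_[p]}
    (hf : Continuous f) : Continuous fun x => stdChar (f x) :=
  continuous_stdChar.comp hf

theorem stdChar_eq_one_of_norm_mul_le {x y : Fin n → ℚ_[p]} (h : ‖x‖ * ‖y‖ ≤ 1) :
    stdChar (x ⬝ᵥ y) = 1 :=
  stdChar_eq_one_of_norm_le ((norm_dotProduct_le x y).trans h)

theorem exists_stdChar_ne_one {M : ℤ} {ξ : Fin n → ℚ_[p]} (h : ¬ ‖ξ‖ ≤ (p : ℝ) ^ (-M)) :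
    ∃ z : Fin n → ℚ_[p], ‖z‖ ≤ (p : ℝ) ^ M ∧ stdChar (z ⬝ᵥ ξ) ≠ 1 := by
  have hp := prime_pos (p := p)
  rw [pi_norm_le_iff_of_nonneg (by positivity)] at h
  push Not at h
  obtain ⟨i, hi⟩ := h
  have hi0 : ξ i ≠ 0 := norm_pos_iff.1 ((by positivity : (0 : ℝ) < _).trans hi)
  -- Norms take values in powers of `p`, so the strict inequality gains a whole factor `p`. This
  -- pays for the norm `p` of `p⁻¹` in the witness, chosen so that `z ⬝ᵥ ξ = p⁻¹`.
  have hi' : (p : ℝ) ^ (-M + 1) ≤ ‖ξ i‖ := by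
    by_contra! hlt
    exact absurd ((Padic.norm_le_pow_iff_norm_lt_pow_add_one _ _).2 hlt) (not_le.2 hi)
  refine ⟨Pi.single i ((p : ℚ_[p])⁻¹ / ξ i), ?_, ?_⟩
  · rw [Pi.norm_single, norm_div, norm_inv, Padic.norm_p, inv_inv,
      div_le_iff₀ (norm_pos_iff.2 hi0)]
    refine le_trans (le_of_eq ?_) (mul_le_mul_of_nonneg_left hi' (by positivity))
    rw [← zpow_add₀ hp.ne']
    simp
  · rw [single_dotProduct, div_mul_cancel₀ _ hi0]
    exact stdChar_inv_prime_ne_one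

/-- If the character is nontrivial on the ball, translating by some `z` in the ball preserves the
integral yet multiplies it by `Ψ(z·ξ) ≠ 1`, so it vanishes. -/
theorem setIntegral_stdChar (M : ℤ) (ξ : Fin n → ℚ_[p]) :
    ∫ y in Metric.closedBall 0 ((p : ℝ) ^ M), stdChar (y ⬝ᵥ ξ) ∂(haar p n) =
      if ‖ξ‖ ≤ (p : ℝ) ^ (-M) then (((p : ℝ) ^ M) ^ n : ℂ) else 0 := by
  have hp := prime_pos (p := p)
  have hB : MeasurableSet (Metric.closedBall (0 : Fin n → ℚ_[p]) ((p : ℝ) ^ M)) :=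
    Metric.isClosed_closedBall.measurableSet
  split_ifs with h
  · rw [setIntegral_congr_fun hB (g := fun _ => (1 : ℂ))]
    · rw [setIntegral_const, measureReal_closedBall]
      simp
    · intro y hy
      refine stdChar_eq_one_of_norm_mul_le ?_
      refine (mul_le_mul (mem_closedBall_zero_iff.1 hy) h (norm_nonneg _)
        (by positivity)).trans_eq ?_
      rw [← zpow_add₀ hp.ne']
      simp
  · obtain ⟨z, hz, hz1⟩ := exists_stdChar_ne_one h
    rw [← integral_indicator hB]
    set F := (Metric.closedBall (0 : Fin n → ℚ_[p]) ((p : ℝ) ^ M)).indicator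
      (fun y => stdChar (y ⬝ᵥ ξ)) with hF
    have hmem : ∀ y, y + z ∈ Metric.closedBall (0 : Fin n → ℚ_[p]) ((p : ℝ) ^ M) ↔
        y ∈ Metric.closedBall (0 : Fin n → ℚ_[p]) ((p : ℝ) ^ M) := fun y => by
      simp only [mem_closedBall_zero_iff]
      constructor
      · intro hy
        rw [← add_sub_cancel_right y z]
        exact dist_eq_norm (y + z) z ▸ dist_le_of_le (y := 0) (by simpa using hy) (by simpa using hz)
      · intro hy
        refine (IsUltrametricDist.norm_add_le_max _ _).trans (max_le hy hz)
    have h1 : ∀ y, F (y + z) = stdChar (z ⬝ᵥ ξ) * F y := fun y => by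
      by_cases hy : y ∈ Metric.closedBall (0 : Fin n → ℚ_[p]) ((p : ℝ) ^ M)
      · rw [hF, Set.indicator_of_mem ((hmem y).2 hy), Set.indicator_of_mem hy, add_dotProduct,
          stdChar_add, mul_comm]
      · rw [hF, Set.indicator_of_notMem (fun h => hy ((hmem y).1 h)),
          Set.indicator_of_notMem hy, mul_zero]
    have h2 := integral_add_right_eq_self (μ := haar p n) F z
    simp only [h1] at h2
    rw [integral_const_mul] at h2
    by_contra h0
    exact hz1 (mul_right_cancel₀ h0 (h2.trans (one_mul _).symm))

end Orthogonality

/-! ### Integrability of power decay -/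

section Integrability

/-- The shell between radii `p^(N+k)` and `p^(N+k+1)` contributes at most a constant times
`p^((n-s)k)`, a convergent geometric series. -/
theorem integrableOn_norm_rpow {s : ℝ} (hs : (n : ℝ) < s) (N : ℤ) :
    IntegrableOn (fun x : Fin n → ℚ_[p] => ‖x‖ ^ (-s)) (Metric.closedBall 0 ((p : ℝ) ^ N))ᶜ
      (haar p n) := by
  have hp := prime_pos (p := p)
  have hs0 : 0 < s := (Nat.cast_nonneg n).trans_lt hs
  let S : ℕ → Set (Fin n → ℚ_[p]) := fun k =>
    Metric.closedBall 0 ((p : ℝ) ^ (N + k + 1)) \ Metric.closedBall 0 ((p : ℝ) ^ (N + k))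
  have hSm : ∀ k, MeasurableSet (S k) := fun k =>
    Metric.isClosed_closedBall.measurableSet.diff Metric.isClosed_closedBall.measurableSet
  have hSfin : ∀ k, haar p n (S k) < ⊤ := fun k =>
    (measure_mono Set.sdiff_subset).trans_lt measure_closedBall_lt_top
  have hbound : ∀ k, ∀ x ∈ S k, ‖‖x‖ ^ (-s)‖ ≤ ((p : ℝ) ^ (N + k)) ^ (-s) := fun k x hx => by
    have hx' : (p : ℝ) ^ (N + k) < ‖x‖ := by simpa [S] using hx.2
    rw [Real.norm_of_nonneg (by positivity)]
    exact Real.rpow_le_rpow_of_nonpos (by positivity) hx'.le (by linarith)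
  have hmeas : Measurable fun x : Fin n → ℚ_[p] => ‖x‖ ^ (-s) := measurable_norm.pow_const _
  have hcover : (Metric.closedBall (0 : Fin n → ℚ_[p]) ((p : ℝ) ^ N))ᶜ ⊆ ⋃ k, S k := by
    intro x hx
    have hx : (p : ℝ) ^ N < ‖x‖ := by simpa using hx
    have hx0 : 0 < ‖x‖ := (by positivity : (0 : ℝ) < (p : ℝ) ^ N).trans hx
    obtain ⟨m, hm, hm'⟩ := exists_mem_Ioc_zpow hx0 (one_lt_prime (p := p))
    have hNm : N ≤ m := by
      by_contra! hlt
      exact absurd (hm'.trans (zpow_le_zpow_right₀ one_lt_prime.le hlt)) (not_le.2 hx)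
    obtain ⟨k, hk⟩ := Int.le.dest hNm
    refine Set.mem_iUnion.2 ⟨k, ?_, ?_⟩
    · simpa [hk] using hm'
    · simpa [hk] using hm
  refine IntegrableOn.mono_set ?_ hcover
  refine integrableOn_iUnion_of_summable_integral_norm (fun k => ?_) ?_
  · refine Measure.integrableOn_of_bounded (hSfin k).ne hmeas.aestronglyMeasurable
      (M := ((p : ℝ) ^ (N + k)) ^ (-s)) ?_
    exact (ae_restrict_iff' (hSm k)).2 (Eventually.of_forall (hbound k))
  · set q : ℝ := (p : ℝ) ^ ((n : ℝ) - s) with hq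
    have hq0 : 0 < q := by positivity
    have hq1 : q < 1 := Real.rpow_lt_one_of_one_lt_of_neg one_lt_prime (by linarith)
    refine Summable.of_nonneg_of_le (fun k => integral_nonneg fun x => norm_nonneg _)
      (fun k => ?_) ((summable_geometric_of_lt_one hq0.le hq1).mul_left ((p : ℝ) ^ n * q ^ N))
    have h1 := norm_setIntegral_le_of_norm_le_const (hSfin k)
      (f := fun x : Fin n → ℚ_[p] => ‖‖x‖ ^ (-s)‖) (C := ((p : ℝ) ^ (N + k)) ^ (-s))
      (fun x hx => by simpa using hbound k x hx)
    refine (le_abs_self _).trans (h1.trans ?_)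
    have h2 : (haar p n).real (S k) ≤ ((p : ℝ) ^ (N + k + 1)) ^ n := by
      rw [← measureReal_closedBall 0]
      exact measureReal_mono Set.sdiff_subset measure_closedBall_lt_top.ne
    refine (mul_le_mul_of_nonneg_left h2 (by positivity)).trans_eq ?_
    have h3 : q ^ N * q ^ k = ((p : ℝ) ^ (N + k)) ^ n * ((p : ℝ) ^ (N + k)) ^ (-s) := by
      rw [← zpow_natCast q k, ← zpow_add₀ hq0.ne', hq, ← Real.rpow_natCast _ n,
        ← Real.rpow_add (by positivity), ← Real.rpow_intCast, ← Real.rpow_intCast,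
        ← Real.rpow_mul hp.le, ← Real.rpow_mul hp.le, mul_comm, sub_eq_add_neg]
    rw [mul_assoc, h3, zpow_add_one₀ hp.ne', mul_pow]
    ring

theorem integrable_of_norm_le_rpow {f : (Fin n → ℚ_[p]) → ℂ}
    (hf : AEStronglyMeasurable f (haar p n)) {s : ℝ} (hs : (n : ℝ) < s) (N : ℤ) {C D : ℝ}
    (hC : ∀ x, ‖x‖ ≤ (p : ℝ) ^ N → ‖f x‖ ≤ C)
    (hD : ∀ x, (p : ℝ) ^ N < ‖x‖ → ‖f x‖ ≤ D * ‖x‖ ^ (-s)) :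
    Integrable f (haar p n) := by
  have hB : MeasurableSet (Metric.closedBall (0 : Fin n → ℚ_[p]) ((p : ℝ) ^ N)) :=
    Metric.isClosed_closedBall.measurableSet
  rw [← integrableOn_univ, ← Set.union_compl_self (Metric.closedBall 0 ((p : ℝ) ^ N)),
    integrableOn_union]
  constructor
  · refine Measure.integrableOn_of_bounded measure_closedBall_lt_top.ne hf (M := C) ?_
    exact (ae_restrict_iff' hB).2 (Eventually.of_forall fun x hx => hC x (by simpa using hx))
  · refine Integrable.mono' ((integrableOn_norm_rpow hs N).const_mul D) hf.restrict ?_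
    exact (ae_restrict_iff' hB.compl).2
      (Eventually.of_forall fun x hx => hD x (by simpa using hx))

end Integrability

/-! ### Fourier inversion by averages over balls -/

section Inversion

theorem tendsto_average_closedBall {f : (Fin n → ℚ_[p]) → ℂ} (hf : Continuous f)
    (ξ : Fin n → ℚ_[p]) :
    Tendsto (fun M : ℕ => (((p : ℝ) ^ (M : ℤ)) ^ n : ℂ) *
      ∫ η in Metric.closedBall ξ ((p : ℝ) ^ (-(M : ℤ))), f η ∂(haar p n)) atTop (𝓝 (f ξ)) := by
  have hp := prime_pos (p := p)
  rw [Metric.tendsto_atTop]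
  intro ε hε
  obtain ⟨δ, hδ, h⟩ := Metric.continuous_iff.1 hf ξ (ε / 2) (by positivity)
  have hlim : Tendsto (fun M : ℕ => (p : ℝ) ^ (-(M : ℤ))) atTop (𝓝 0) := by
    simp_rw [zpow_neg, zpow_natCast, ← inv_pow]
    exact tendsto_pow_atTop_nhds_zero_of_lt_one (by positivity) (inv_lt_one_of_one_lt₀ one_lt_prime)
  obtain ⟨N, hN⟩ := ((tendsto_order.1 hlim).2 δ hδ).exists_forall_of_atTop
  refine ⟨N, fun M hM => lt_of_le_of_lt ?_ (half_lt_self hε)⟩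
  set B := Metric.closedBall ξ ((p : ℝ) ^ (-(M : ℤ))) with hBdef
  have hvol : (((p : ℝ) ^ (M : ℤ)) ^ n) * (haar p n).real B = 1 := by
    rw [hBdef, measureReal_closedBall, ← mul_pow, ← zpow_add₀ hp.ne']
    simp
  have hvolc : (((p : ℝ) ^ (M : ℤ)) ^ n : ℂ) * ((haar p n).real B : ℂ) = 1 := by
    exact_mod_cast hvol
  have hint : IntegrableOn f B (haar p n) :=
    hf.continuousOn.integrableOn_compact (isCompact_closedBall _ _)
  have hconst : IntegrableOn (fun _ => f ξ) B (haar p n) :=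
    continuousOn_const.integrableOn_compact (isCompact_closedBall _ _)
  have h1 : (((p : ℝ) ^ (M : ℤ)) ^ n : ℂ) * (∫ η in B, f η ∂(haar p n)) - f ξ =
      (((p : ℝ) ^ (M : ℤ)) ^ n : ℂ) * ∫ η in B, (f η - f ξ) ∂(haar p n) := by
    rw [integral_sub hint hconst, setIntegral_const, mul_sub, Complex.real_smul, ← mul_assoc,
      hvolc, one_mul]
  have h2 := norm_setIntegral_le_of_norm_le_const (μ := haar p n) (s := B)
    (f := fun η => f η - f ξ) (C := ε / 2) measure_closedBall_lt_top (fun η hη => by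
      rw [← dist_eq_norm]
      exact (h η ((Metric.mem_closedBall.1 hη).trans_lt (hN M hM))).le)
  rw [dist_eq_norm, h1, norm_mul]
  calc _ ≤ (((p : ℝ) ^ (M : ℤ)) ^ n) * (ε / 2 * (haar p n).real B) := by
        refine mul_le_mul (le_of_eq ?_) h2 (norm_nonneg _) (by positivity)
        simp
    _ = ε / 2 := by rw [mul_left_comm, hvol, mul_one]

theorem integrable_mul_stdChar {f : (Fin n → ℚ_[p]) → ℂ} (hf : Integrable f (haar p n))
    (x : Fin n → ℚ_[p]) : Integrable (fun ξ => f ξ * stdChar (x ⬝ᵥ ξ)) (haar p n) :=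
  hf.mul_bdd (c := 1) (by fun_prop : Continuous fun ξ => stdChar (x ⬝ᵥ ξ)).aestronglyMeasurable
    (Eventually.of_forall fun ξ => by simp)

theorem norm_invFourier_le (f : (Fin n → ℚ_[p]) → ℂ) (x : Fin n → ℚ_[p]) :
    ‖invFourier f x‖ ≤ ∫ ξ, ‖f ξ‖ ∂(haar p n) :=
  (norm_integral_le_integral_norm _).trans_eq (by simp)

theorem continuous_invFourier {f : (Fin n → ℚ_[p]) → ℂ} (hf : Integrable f (haar p n)) :
    Continuous (invFourier f) := by
  refine continuous_of_dominated (fun x => (integrable_mul_stdChar hf x).aestronglyMeasurable)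
    (bound := fun ξ => ‖f ξ‖) (fun x => Eventually.of_forall fun ξ => by simp) hf.norm
    (Eventually.of_forall fun ξ => by fun_prop)

/-- After Fubini the inner integral is that of `Ψ(y·(η-ξ))` over a ball, which restricts `η` to the
dual ball about `ξ`. -/
theorem setIntegral_invFourier_mul_stdChar {f : (Fin n → ℚ_[p]) → ℂ}
    (hf : Integrable f (haar p n)) (ξ : Fin n → ℚ_[p]) (M : ℤ) :
    ∫ y in Metric.closedBall 0 ((p : ℝ) ^ M), invFourier f y * stdChar (-(y ⬝ᵥ ξ)) ∂(haar p n) =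
      (((p : ℝ) ^ M) ^ n : ℂ) *
        ∫ η in Metric.closedBall ξ ((p : ℝ) ^ (-M)), f η ∂(haar p n) := by
  have hB : MeasurableSet (Metric.closedBall ξ ((p : ℝ) ^ (-M))) :=
    Metric.isClosed_closedBall.measurableSet
  have : IsFiniteMeasure ((haar p n).restrict (Metric.closedBall 0 ((p : ℝ) ^ M))) :=
    ⟨by rw [Measure.restrict_apply_univ]; exact measure_closedBall_lt_top⟩
  have hint : Integrable (Function.uncurry fun y η : Fin n → ℚ_[p] =>
      f η * stdChar (y ⬝ᵥ (η - ξ)))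
      (((haar p n).restrict (Metric.closedBall 0 ((p : ℝ) ^ M))).prod (haar p n)) := by
    refine (hf.comp_snd _).mul_bdd (c := 1) ?_ (Eventually.of_forall fun z => by simp)
    exact (by fun_prop : Continuous fun z : (Fin n → ℚ_[p]) × (Fin n → ℚ_[p]) =>
      stdChar (z.1 ⬝ᵥ (z.2 - ξ))).aestronglyMeasurable
  have h1 : ∀ y, invFourier f y * stdChar (-(y ⬝ᵥ ξ)) =
      ∫ η, f η * stdChar (y ⬝ᵥ (η - ξ)) ∂(haar p n) := fun y => by
    rw [invFourier, ← integral_mul_const]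
    simp_rw [dotProduct_sub, sub_eq_add_neg, stdChar_add, mul_assoc]
  simp_rw [h1]
  rw [integral_integral_swap hint]
  simp_rw [integral_const_mul, setIntegral_stdChar]
  rw [← integral_indicator hB, ← integral_const_mul]
  refine integral_congr_ae (Eventually.of_forall fun η => ?_)
  simp only [Set.indicator, Metric.mem_closedBall, dist_eq_norm]
  split_ifs <;> ring

open scoped ComplexOrder

/-- For a nonnegative function, convergence of the integrals over growing balls suffices; here they
are averages of `f` around `0`, converging to `f 0`. -/
theorem integrable_invFourier {f : (Fin n → ℚ_[p]) → ℂ} (hf : Integrable f (haar p n))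
    (hfc : Continuous f) (hpos : ∀ x, 0 ≤ invFourier f x) :
    Integrable (invFourier f) (haar p n) := by
  have hre : ∀ x, invFourier f x = ((invFourier f x).re : ℂ) := fun x =>
    Complex.ext rfl (by simpa using (Complex.nonneg_iff.1 (hpos x)).2.symm)
  have hc := continuous_invFourier hf
  have hcov : AECover (haar p n) atTop
      (fun M : ℕ => Metric.closedBall (0 : Fin n → ℚ_[p]) ((p : ℝ) ^ (M : ℤ))) :=
    aecover_closedBall (by
      simpa using tendsto_pow_atTop_atTop_of_one_lt (one_lt_prime (p := p)))
  have h1 : Integrable (fun x => (invFourier f x).re) (haar p n) := by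
    refine hcov.integrable_of_integral_tendsto_of_nonneg_ae (f 0).re (fun M => ?_)
      (Eventually.of_forall fun x => (Complex.nonneg_iff.1 (hpos x)).1) ?_
    · exact (Complex.continuous_re.comp hc).continuousOn.integrableOn_compact
        (isCompact_closedBall _ _)
    · refine ((Complex.continuous_re.tendsto _).comp (tendsto_average_closedBall hfc 0)).congr
        fun M => ?_
      rw [Function.comp_apply, ← setIntegral_invFourier_mul_stdChar hf 0 M]
      simp only [dotProduct_zero, neg_zero, stdChar_zero, mul_one]
      rw [integral_congr_ae (Eventually.of_forall hre), integral_complex_ofReal, Complex.ofReal_re]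
  exact h1.ofReal.congr (Eventually.of_forall fun x => (hre x).symm)

theorem integral_invFourier_mul_stdChar {f : (Fin n → ℚ_[p]) → ℂ} (hf : Integrable f (haar p n))
    (hfc : Continuous f) (hpos : ∀ x, 0 ≤ invFourier f x) (ξ : Fin n → ℚ_[p]) :
    ∫ y, invFourier f y * stdChar (-(y ⬝ᵥ ξ)) ∂(haar p n) = f ξ := by
  have hcov : AECover (haar p n) atTop
      (fun M : ℕ => Metric.closedBall (0 : Fin n → ℚ_[p]) ((p : ℝ) ^ (M : ℤ))) :=
    aecover_closedBall (by
      simpa using tendsto_pow_atTop_atTop_of_one_lt (one_lt_prime (p := p)))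
  have hint : Integrable (fun y => invFourier f y * stdChar (-(y ⬝ᵥ ξ))) (haar p n) :=
    (integrable_invFourier hf hfc hpos).mul_bdd (c := 1)
      (by fun_prop : Continuous fun y => stdChar (-(y ⬝ᵥ ξ))).aestronglyMeasurable
      (Eventually.of_forall fun y => by simp)
  refine tendsto_nhds_unique (hcov.integral_tendsto_of_countably_generated hint) ?_
  exact (tendsto_average_closedBall hfc ξ).congr fun M =>
    (setIntegral_invFourier_mul_stdChar hf ξ M).symm

end Inversion

/-! ### Positivity of exponentials of Fourier transforms -/

section Positivity

open scoped ComplexOrder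

/-- Each extra factor of the transform convolves the result in `x` with `J ≥ 0`. The induction
starts from the transform of a ball indicator. -/
theorem setIntegral_pow_invFourier_mul_stdChar_nonneg {J : (Fin n → ℚ_[p]) → ℂ}
    (hJ : Integrable J (haar p n)) (hpos : ∀ y, 0 ≤ J y) (N : ℤ) (k : ℕ) (x : Fin n → ℚ_[p]) :
    0 ≤ ∫ ξ in Metric.closedBall 0 ((p : ℝ) ^ N),
      invFourier J (-ξ) ^ k * stdChar (x ⬝ᵥ ξ) ∂(haar p n) := by
  induction k generalizing x with
  | zero =>
    have hp := prime_pos (p := p)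
    simp_rw [pow_zero, one_mul, dotProduct_comm x, setIntegral_stdChar]
    split_ifs
    · exact_mod_cast (by positivity : (0 : ℝ) ≤ ((p : ℝ) ^ N) ^ n)
    · exact le_rfl
  | succ k ih =>
    have hc := continuous_invFourier hJ
    have : IsFiniteMeasure ((haar p n).restrict (Metric.closedBall 0 ((p : ℝ) ^ N))) :=
      ⟨by rw [Measure.restrict_apply_univ]; exact measure_closedBall_lt_top⟩
    have hG : IntegrableOn (fun ξ => invFourier J (-ξ) ^ k)
        (Metric.closedBall 0 ((p : ℝ) ^ N)) (haar p n) :=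
      (by fun_prop : Continuous fun ξ => invFourier J (-ξ) ^ k).continuousOn.integrableOn_compact
        (isCompact_closedBall _ _)
    have hint : Integrable (Function.uncurry fun ξ y : Fin n → ℚ_[p] =>
        invFourier J (-ξ) ^ k * J y * stdChar ((x - y) ⬝ᵥ ξ))
        (((haar p n).restrict (Metric.closedBall 0 ((p : ℝ) ^ N))).prod (haar p n)) := by
      refine (Integrable.mul_prod hG hJ).mul_bdd (c := 1) ?_ (Eventually.of_forall fun z => by simp)
      exact (by fun_prop : Continuous fun z : (Fin n → ℚ_[p]) × (Fin n → ℚ_[p]) =>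
        stdChar ((x - z.2) ⬝ᵥ z.1)).aestronglyMeasurable
    have h1 : ∀ ξ, invFourier J (-ξ) ^ (k + 1) * stdChar (x ⬝ᵥ ξ) =
        ∫ y, invFourier J (-ξ) ^ k * J y * stdChar ((x - y) ⬝ᵥ ξ) ∂(haar p n) := fun ξ => by
      rw [pow_succ, mul_assoc]
      nth_rewrite 2 [invFourier]
      rw [← integral_mul_const, ← integral_const_mul]
      refine integral_congr_ae (Eventually.of_forall fun y => ?_)
      simp only
      rw [sub_dotProduct, sub_eq_add_neg, stdChar_add, neg_dotProduct, dotProduct_comm y]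
      ring
    simp_rw [h1]
    rw [integral_integral_swap hint]
    refine integral_nonneg fun y => ?_
    have h2 : ∀ ξ, invFourier J (-ξ) ^ k * J y * stdChar ((x - y) ⬝ᵥ ξ) =
        J y * (invFourier J (-ξ) ^ k * stdChar ((x - y) ⬝ᵥ ξ)) := fun ξ => by ring
    simp_rw [h2]
    rw [integral_const_mul]
    exact mul_nonneg (hpos y) (ih (x - y))

/-- Termwise integration of the exponential series is justified by the bound `(s‖J‖₁)^k / k!` on a
ball of finite measure. -/
theorem setIntegral_exp_invFourier_mul_stdChar_nonneg {J : (Fin n → ℚ_[p]) → ℂ}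
    (hJ : Integrable J (haar p n)) (hpos : ∀ y, 0 ≤ J y) {s : ℝ} (hs : 0 ≤ s) (N : ℤ)
    (x : Fin n → ℚ_[p]) :
    0 ≤ ∫ ξ in Metric.closedBall 0 ((p : ℝ) ^ N),
      Complex.exp (s * invFourier J (-ξ)) * stdChar (x ⬝ᵥ ξ) ∂(haar p n) := by
  have hc := continuous_invFourier hJ
  set F : ℕ → (Fin n → ℚ_[p]) → ℂ := fun k ξ =>
    (((s ^ k / k.factorial : ℝ)) : ℂ) * (invFourier J (-ξ) ^ k * stdChar (x ⬝ᵥ ξ)) with hF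
  set K := ∫ ξ, ‖J ξ‖ ∂(haar p n)
  have hK : 0 ≤ K := integral_nonneg fun _ => norm_nonneg _
  have hFint : ∀ k, IntegrableOn (F k) (Metric.closedBall 0 ((p : ℝ) ^ N)) (haar p n) := fun k =>
    (by fun_prop : Continuous (F k)).continuousOn.integrableOn_compact (isCompact_closedBall _ _)
  have hFle : ∀ k ξ, ‖F k ξ‖ ≤ (s * K) ^ k / k.factorial := fun k ξ => by
    rw [hF, norm_mul, norm_mul, norm_stdChar, mul_one, norm_pow, Complex.norm_real,
      Real.norm_of_nonneg (by positivity), mul_pow, mul_div_right_comm]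
    exact mul_le_mul_of_nonneg_left
      (pow_le_pow_left₀ (norm_nonneg _) (norm_invFourier_le J _) k) (by positivity)
  have hsum : Summable fun k => ∫ ξ in Metric.closedBall 0 ((p : ℝ) ^ N), ‖F k ξ‖ ∂(haar p n) := by
    refine Summable.of_nonneg_of_le (fun k => integral_nonneg fun _ => norm_nonneg _)
      (fun k => ?_) ((Real.summable_pow_div_factorial (s * K)).mul_right
        ((haar p n).real (Metric.closedBall 0 ((p : ℝ) ^ N))))
    exact (le_abs_self _).trans (norm_setIntegral_le_of_norm_le_const
      (f := fun ξ => ‖F k ξ‖) measure_closedBall_lt_top fun ξ _ => by simpa using hFle k ξ)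
  have hS := hasSum_integral_of_summable_integral_norm hFint hsum
  have htsum : ∀ ξ, ∑' k, F k ξ = Complex.exp (s * invFourier J (-ξ)) * stdChar (x ⬝ᵥ ξ) :=
    fun ξ => by
      rw [Complex.exp_eq_exp_ℂ, NormedSpace.exp_eq_tsum_div, ← tsum_mul_right]
      refine tsum_congr fun k => ?_
      rw [hF, mul_pow]
      push_cast
      ring
  simp_rw [htsum] at hS
  refine hS.nonneg fun k => ?_
  rw [hF, integral_const_mul]
  refine mul_nonneg ?_ (setIntegral_pow_invFourier_mul_stdChar_nonneg hJ hpos N k x)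
  exact_mod_cast (by positivity : (0 : ℝ) ≤ s ^ k / k.factorial)

end Positivity

/-! ### The symbol: continuity, growth, and positivity of the kernel -/

section Symbol

variable {w : (Fin n → ℚ_[p]) → ℝ}

/-- The function `1 / w` cut off to the complement of the ball of radius `p ^ (-N)`. -/
def truncatedInverse (w : (Fin n → ℚ_[p]) → ℝ) (N : ℤ) : (Fin n → ℚ_[p]) → ℂ :=
  (Metric.closedBall 0 ((p : ℝ) ^ (-N)))ᶜ.indicator fun y => (((w y)⁻¹ : ℝ) : ℂ)

theorem exists_norm_lt_zpow (ξ : Fin n → ℚ_[p]) : ∃ N : ℤ, ‖ξ‖ < (p : ℝ) ^ N := by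
  obtain ⟨N, hN⟩ := pow_unbounded_of_one_lt ‖ξ‖ (one_lt_prime (p := p))
  exact ⟨N, by simpa using hN⟩

theorem integrable_truncatedInverse (hw : Continuous w) {C₀ α : ℝ} (hC₀ : 0 < C₀)
    (hα : (n : ℝ) < α) (hlow : ∀ y, C₀ * ‖y‖ ^ α ≤ w y) (N : ℤ) :
    Integrable (truncatedInverse w N) (haar p n) := by
  have hp := prime_pos (p := p)
  refine integrable_of_norm_le_rpow ?_ hα (-N) (C := 0) (D := C₀⁻¹) ?_ ?_
  · refine (Measurable.indicator ?_
      Metric.isClosed_closedBall.measurableSet.compl).aestronglyMeasurable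
    exact Complex.measurable_ofReal.comp hw.measurable.inv
  · intro x hx
    rw [truncatedInverse, Set.indicator_of_notMem (by simpa using hx), norm_zero]
  · intro x hx
    have hx0 : 0 < ‖x‖ := (by positivity : (0 : ℝ) < (p : ℝ) ^ (-N)).trans hx
    have hpos : 0 < C₀ * ‖x‖ ^ α := by positivity
    rw [truncatedInverse, Set.indicator_of_mem (by simpa using hx), Complex.norm_real, norm_inv,
      Real.norm_of_nonneg (hpos.le.trans (hlow x)), Real.rpow_neg hx0.le, ← mul_inv]
    exact inv_anti₀ hpos (hlow x)

/-- On the removed ball `y·ξ` lies in `ℤ_p`, so the numerator `1 - Ψ` already vanishes and the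
truncation loses nothing. -/
theorem symbolIntegrand_eq_truncatedInverse_mul {ξ : Fin n → ℚ_[p]} {N : ℤ}
    (hξ : ‖ξ‖ ≤ (p : ℝ) ^ N) (y : Fin n → ℚ_[p]) :
    symbolIntegrand w ξ y =
      truncatedInverse w N y - truncatedInverse w N y * stdChar ((-ξ) ⬝ᵥ y) := by
  have hp := prime_pos (p := p)
  rw [symbolIntegrand, neg_dotProduct, dotProduct_comm ξ]
  by_cases hy : ‖y‖ ≤ (p : ℝ) ^ (-N)
  · rw [truncatedInverse, Set.indicator_of_notMem (by simpa using hy), ← dotProduct_neg,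
      stdChar_eq_one_of_norm_mul_le]
    · simp
    · rw [norm_neg]
      refine (mul_le_mul hy hξ (norm_nonneg _) (by positivity)).trans_eq ?_
      rw [← zpow_add₀ hp.ne']
      simp
  · rw [truncatedInverse, Set.indicator_of_mem (by simpa using hy)]
    push_cast
    ring

theorem integrable_symbolIntegrand (hJ : ∀ N, Integrable (truncatedInverse w N) (haar p n))
    (ξ : Fin n → ℚ_[p]) : Integrable (symbolIntegrand w ξ) (haar p n) := by
  obtain ⟨N, hN⟩ := exists_norm_lt_zpow ξ
  refine ((hJ N).sub (integrable_mul_stdChar (hJ N) (-ξ))).congr (Eventually.of_forall fun y => ?_)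
  exact (symbolIntegrand_eq_truncatedInverse_mul hN.le y).symm

theorem symbol_eq_sub_invFourier (hJ : ∀ N, Integrable (truncatedInverse w N) (haar p n))
    {ξ : Fin n → ℚ_[p]} {N : ℤ} (hξ : ‖ξ‖ ≤ (p : ℝ) ^ N) :
    symbol w ξ = ∫ y, truncatedInverse w N y ∂(haar p n) -
      invFourier (truncatedInverse w N) (-ξ) := by
  rw [symbol, invFourier, ← integral_sub (hJ N) (integrable_mul_stdChar (hJ N) (-ξ))]
  exact integral_congr_ae
    (Eventually.of_forall fun y => symbolIntegrand_eq_truncatedInverse_mul hξ y)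

theorem continuous_symbol (hJ : ∀ N, Integrable (truncatedInverse w N) (haar p n)) :
    Continuous (symbol w) := by
  refine continuous_iff_continuousAt.2 fun ξ => ?_
  obtain ⟨N, hN⟩ := exists_norm_lt_zpow ξ
  have hc := continuous_invFourier (hJ N)
  refine ((by fun_prop : Continuous fun ξ => ∫ y, truncatedInverse w N y ∂(haar p n) -
      invFourier (truncatedInverse w N) (-ξ)).continuousAt (x := ξ)).congr ?_
  filter_upwards [continuous_norm.tendsto ξ |>.eventually_lt_const hN] with η hη
  exact (symbol_eq_sub_invFourier hJ hη.le).symm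

theorem continuous_expSymbol (hJ : ∀ N, Integrable (truncatedInverse w N) (haar p n)) (κ t : ℝ) :
    Continuous (expSymbol w κ t) := by
  have := continuous_symbol hJ
  unfold expSymbol
  fun_prop

theorem expSymbol_zero_right (κ t : ℝ) : expSymbol w κ t 0 = 1 := by
  simp [expSymbol, symbol, symbolIntegrand]

theorem expSymbol_add (κ t t' : ℝ) (ξ : Fin n → ℚ_[p]) :
    expSymbol w κ (t + t') ξ = expSymbol w κ t ξ * expSymbol w κ t' ξ := by
  rw [expSymbol, expSymbol, expSymbol, ← Complex.exp_add]
  congr 1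
  push_cast
  ring

theorem re_stdChar_le_one (y : ℚ_[p]) : (stdChar y).re ≤ 1 :=
  (Complex.re_le_norm _).trans_eq (norm_stdChar y)

theorem re_symbolIntegrand (ξ y : Fin n → ℚ_[p]) :
    (symbolIntegrand w ξ y).re = (1 - (stdChar (-(y ⬝ᵥ ξ))).re) / w y := by
  rw [symbolIntegrand, Complex.div_ofReal_re]
  simp

theorem re_symbolIntegrand_nonneg (hw : ∀ y, 0 ≤ w y) (ξ y : Fin n → ℚ_[p]) :
    0 ≤ (symbolIntegrand w ξ y).re := by
  rw [re_symbolIntegrand]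
  exact div_nonneg (sub_nonneg.2 (re_stdChar_le_one _)) (hw y)

theorem re_symbol (hJ : ∀ N, Integrable (truncatedInverse w N) (haar p n))
    (ξ : Fin n → ℚ_[p]) : (symbol w ξ).re = ∫ y, (symbolIntegrand w ξ y).re ∂(haar p n) :=
  (integral_re (integrable_symbolIntegrand hJ ξ)).symm

theorem re_symbol_nonneg (hJ : ∀ N, Integrable (truncatedInverse w N) (haar p n))
    (hw : ∀ y, 0 ≤ w y) (ξ : Fin n → ℚ_[p]) : 0 ≤ (symbol w ξ).re := by
  rw [re_symbol hJ]
  exact integral_nonneg fun y => re_symbolIntegrand_nonneg hw ξ y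

theorem norm_expSymbol (κ t : ℝ) (ξ : Fin n → ℚ_[p]) :
    ‖expSymbol w κ t ξ‖ = Real.exp (-(κ * t * (symbol w ξ).re)) := by
  rw [expSymbol, Complex.norm_exp, ← Complex.ofReal_neg, ← Complex.ofReal_mul, Complex.re_ofReal_mul]
  congr 1
  ring

theorem norm_expSymbol_le_one (hJ : ∀ N, Integrable (truncatedInverse w N) (haar p n))
    (hw : ∀ y, 0 ≤ w y) {κ t : ℝ} (hκ : 0 ≤ κ) (ht : 0 ≤ t) (ξ : Fin n → ℚ_[p]) :
    ‖expSymbol w κ t ξ‖ ≤ 1 := by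
  rw [norm_expSymbol, Real.exp_le_one_iff, neg_nonpos]
  have := re_symbol_nonneg hJ hw ξ
  positivity

/-- The real integrand is nonnegative, so it may be restricted to the ball of radius `p^(-m)`. There
`w ≤ W`, and the character averages to zero because `‖ξ‖ > p^m`, leaving volume over `W`. -/
theorem measureReal_div_le_re_symbol (hJ : ∀ N, Integrable (truncatedInverse w N) (haar p n))
    (hw : ∀ y, 0 ≤ w y) (hw0 : ∀ y, w y = 0 → y = 0) {ξ : Fin n → ℚ_[p]} {m : ℤ}
    (hξ : (p : ℝ) ^ m < ‖ξ‖) {W : ℝ} (hW : ∀ y, ‖y‖ ≤ (p : ℝ) ^ (-m) → w y ≤ W) :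
    ((p : ℝ) ^ (-m)) ^ n / W ≤ (symbol w ξ).re := by
  have hp := prime_pos (p := p)
  set B := Metric.closedBall (0 : Fin n → ℚ_[p]) ((p : ℝ) ^ (-m)) with hBdef
  have hB : MeasurableSet B := Metric.isClosed_closedBall.measurableSet
  have hre : Integrable (fun y => (symbolIntegrand w ξ y).re) (haar p n) :=
    (integrable_symbolIntegrand hJ ξ).re
  have hψ : IntegrableOn (fun y => stdChar (y ⬝ᵥ (-ξ))) B (haar p n) :=
    (by fun_prop : Continuous fun y => stdChar (y ⬝ᵥ (-ξ))).continuousOn.integrableOn_compact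
      (isCompact_closedBall _ _)
  have hψre : IntegrableOn (fun y => (stdChar (y ⬝ᵥ (-ξ))).re) B (haar p n) := hψ.re
  have h1 : IntegrableOn (fun _ => (1 : ℝ)) B (haar p n) :=
    continuousOn_const.integrableOn_compact (isCompact_closedBall _ _)
  have h0 : ∫ y in B, (stdChar (y ⬝ᵥ (-ξ))).re ∂(haar p n) = 0 := by
    have h := setIntegral_stdChar (-m) (-ξ)
    rw [norm_neg, neg_neg, if_neg (not_le.2 hξ)] at h
    have h' := integral_re hψ
    rw [h] at h'
    simpa using h'
  calc ((p : ℝ) ^ (-m)) ^ n / W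
      = ∫ y in B, (1 - (stdChar (y ⬝ᵥ (-ξ))).re) / W ∂(haar p n) := by
        rw [integral_div, integral_sub h1 hψre, h0, setIntegral_const, hBdef, measureReal_closedBall]
        simp
    _ ≤ ∫ y in B, (symbolIntegrand w ξ y).re ∂(haar p n) := by
        refine setIntegral_mono_on ((h1.sub hψre).div_const W) hre.integrableOn hB fun y hy => ?_
        rw [re_symbolIntegrand, dotProduct_neg]
        -- At the zero of `w` both numerators vanish; elsewhere `w y > 0`.
        rcases eq_or_ne y 0 with rfl | hy0
        · simp
        · exact div_le_div_of_nonneg_left (sub_nonneg.2 (re_stdChar_le_one _))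
            ((hw y).lt_of_ne fun h => hy0 (hw0 y h.symm)) (hW y (by simpa [B] using hy))
    _ ≤ (symbol w ξ).re := by
        rw [re_symbol hJ]
        exact setIntegral_le_integral hre
          (Eventually.of_forall fun y => re_symbolIntegrand_nonneg hw ξ y)

theorem exists_rpow_le_re_symbol (hJ : ∀ N, Integrable (truncatedInverse w N) (haar p n))
    (hw : ∀ y, 0 ≤ w y) (hw0 : ∀ y, w y = 0 → y = 0) {C₁ α₂ α₃ : ℝ} (hC₁ : 0 < C₁)
    (hα₂ : (n : ℝ) < α₂) (hα₃ : 0 ≤ α₃)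
    (hup : ∀ y, w y ≤ C₁ * ‖y‖ ^ α₂ * Real.exp (α₃ * ‖y‖)) :
    ∃ c : ℝ, 0 < c ∧ ∀ ξ : Fin n → ℚ_[p], 1 < ‖ξ‖ → c * ‖ξ‖ ^ (α₂ - n) ≤ (symbol w ξ).re := by
  have hp := prime_pos (p := p)
  have hα₂0 : 0 < α₂ := (Nat.cast_nonneg n).trans_lt hα₂
  -- The factor `p^(-(α₂ - n))` pays for rounding `‖ξ‖` down to a power of `p`; `e^α₃` bounds the
  -- exponential, since the test ball has radius at most `1`.
  refine ⟨((p : ℝ) ^ (α₂ - n))⁻¹ / (C₁ * Real.exp α₃), by positivity, fun ξ hξ => ?_⟩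
  obtain ⟨m, hm, hm'⟩ := exists_mem_Ioc_zpow (one_pos.trans hξ) (one_lt_prime (p := p))
  have hm0 : 0 ≤ m := by
    by_contra! hlt
    exact absurd (hm'.trans (zpow_le_one_of_nonpos₀ one_lt_prime.le hlt)) (not_le.2 hξ)
  have hr : (0 : ℝ) < (p : ℝ) ^ (-m) := by positivity
  have hr1 : (p : ℝ) ^ (-m) ≤ 1 := zpow_le_one_of_nonpos₀ one_lt_prime.le (by omega)
  have key := measureReal_div_le_re_symbol hJ hw hw0 hm
    (W := C₁ * ((p : ℝ) ^ (-m)) ^ α₂ * Real.exp α₃) fun y hy => by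
      refine (hup y).trans ?_
      gcongr
      exact mul_le_of_le_one_right hα₃ (hy.trans hr1)
  refine le_trans ?_ key
  have h1 : ‖ξ‖ ^ (α₂ - n) ≤ ((p : ℝ) ^ m) ^ (α₂ - n) * (p : ℝ) ^ (α₂ - n) := by
    rw [← Real.mul_rpow (by positivity) hp.le, ← zpow_add_one₀ hp.ne']
    exact Real.rpow_le_rpow (norm_nonneg _) hm' (by linarith)
  calc _ ≤ ((p : ℝ) ^ (α₂ - n))⁻¹ / (C₁ * Real.exp α₃) *
        (((p : ℝ) ^ m) ^ (α₂ - n) * (p : ℝ) ^ (α₂ - n)) := by gcongr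
    _ = ((p : ℝ) ^ m) ^ (α₂ - n) / (C₁ * Real.exp α₃) := by field_simp
    _ = _ := by
      rw [zpow_neg, inv_pow, Real.inv_rpow (by positivity), Real.rpow_sub (by positivity), Real.rpow_natCast]
      field_simp

theorem integrable_expSymbol (hJ : ∀ N, Integrable (truncatedInverse w N) (haar p n))
    (hw : ∀ y, 0 ≤ w y) {c β : ℝ} (hc : 0 < c) (hβ : 0 < β)
    (hlow : ∀ ξ : Fin n → ℚ_[p], 1 < ‖ξ‖ → c * ‖ξ‖ ^ β ≤ (symbol w ξ).re)
    {κ t : ℝ} (hκ : 0 < κ) (ht : 0 < t) : Integrable (expSymbol w κ t) (haar p n) := by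
  -- With `βk > n`, the bound `e^(-x) ≤ k!/x^k` already gives integrable decay.
  obtain ⟨k, hk⟩ := exists_nat_gt ((n : ℝ) / β)
  rw [div_lt_iff₀ hβ, mul_comm] at hk
  refine integrable_of_norm_le_rpow (continuous_expSymbol hJ κ t).aestronglyMeasurable hk 0
    (C := 1) (D := k.factorial / (κ * t * c) ^ k)
    (fun ξ _ => norm_expSymbol_le_one hJ hw hκ.le ht.le ξ) fun ξ hξ => ?_
  rw [zpow_zero] at hξ
  have hξ0 := one_pos.trans hξ
  have hx : 0 < κ * t * (c * ‖ξ‖ ^ β) := by positivity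
  calc ‖expSymbol w κ t ξ‖ ≤ Real.exp (-(κ * t * (c * ‖ξ‖ ^ β))) := by
        rw [norm_expSymbol]
        gcongr
        exact hlow ξ hξ
    _ ≤ ((κ * t * (c * ‖ξ‖ ^ β)) ^ k / k.factorial)⁻¹ := by
        rw [Real.exp_neg]
        exact inv_anti₀ (by positivity) (Real.pow_div_factorial_le_exp _ hx.le k)
    _ = k.factorial / (κ * t * c) ^ k * ‖ξ‖ ^ (-(β * k)) := by
        rw [Real.rpow_neg hξ0.le, Real.rpow_mul hξ0.le, Real.rpow_natCast, inv_div,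
          ← mul_assoc (κ * t), mul_pow]
        field_simp

open scoped ComplexOrder

theorem truncatedInverse_nonneg (hw : ∀ y, 0 ≤ w y) (N : ℤ) (y : Fin n → ℚ_[p]) :
    0 ≤ truncatedInverse w N y := by
  refine Set.indicator_nonneg (fun y _ => ?_) y
  exact_mod_cast inv_nonneg.2 (hw y)

theorem heatKernel_nonneg (hJ : ∀ N, Integrable (truncatedInverse w N) (haar p n))
    (hw : ∀ y, 0 ≤ w y) {κ t : ℝ} (hκ : 0 ≤ κ) (ht : 0 ≤ t)
    (he : Integrable (expSymbol w κ t) (haar p n)) (x : Fin n → ℚ_[p]) :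
    0 ≤ heatKernel w κ t x := by
  have hcov : AECover (haar p n) atTop
      (fun M : ℕ => Metric.closedBall (0 : Fin n → ℚ_[p]) ((p : ℝ) ^ (M : ℤ))) :=
    aecover_closedBall (by
      simpa using tendsto_pow_atTop_atTop_of_one_lt (one_lt_prime (p := p)))
  refine ge_of_tendsto' (hcov.integral_tendsto_of_countably_generated
    (integrable_mul_stdChar he x)) fun M => ?_
  -- The cutoff depends on the ball of integration: on it, `-κtA_w` is `-κtc` plus `κt` times a
  -- transform of a nonnegative function.
  set c := ∫ y, truncatedInverse w (M : ℤ) y ∂(haar p n) with hc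
  have hc0 : 0 ≤ c := integral_nonneg fun y => truncatedInverse_nonneg hw M y
  have hcre : c = (c.re : ℂ) :=
    Complex.ext rfl (by simpa using (Complex.nonneg_iff.1 hc0).2.symm)
  have h1 : ∀ ξ ∈ Metric.closedBall (0 : Fin n → ℚ_[p]) ((p : ℝ) ^ (M : ℤ)),
      expSymbol w κ t ξ * stdChar (x ⬝ᵥ ξ) = (Real.exp (-(κ * t * c.re)) : ℂ) *
        (Complex.exp ((κ * t : ℝ) * invFourier (truncatedInverse w (M : ℤ)) (-ξ)) *
          stdChar (x ⬝ᵥ ξ)) := fun ξ hξ => by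
    rw [expSymbol, symbol_eq_sub_invFourier hJ (N := M) (by simpa using hξ), ← hc, hcre,
      ← mul_assoc, Complex.ofReal_exp, ← Complex.exp_add]
    congr 2
    push_cast [Complex.ofReal_re]
    ring
  rw [setIntegral_congr_fun Metric.isClosed_closedBall.measurableSet h1, integral_const_mul]
  refine mul_nonneg ?_ (setIntegral_exp_invFourier_mul_stdChar_nonneg (hJ M)
    (truncatedInverse_nonneg hw M) (mul_nonneg hκ ht) M x)
  exact_mod_cast (Real.exp_pos _).le

end Symbol

/-! ### Convolution against an inverse transform -/

section Convolution

theorem convolutionExists_invFourier {f g : (Fin n → ℚ_[p]) → ℂ}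
    (hf : Integrable f (haar p n)) (hg : Integrable g (haar p n)) :
    ConvolutionExists f (invFourier g) (ContinuousLinearMap.mul ℂ ℂ) (haar p n) := by
  intro x
  have hc := continuous_invFourier hg
  refine hf.mul_bdd (c := ∫ ξ, ‖g ξ‖ ∂(haar p n))
    (by fun_prop : Continuous fun y => invFourier g (x - y)).aestronglyMeasurable
    (Eventually.of_forall fun y => norm_invFourier_le g _)

/-- By Fubini only `g` has to be written as an inverse transform; integrating `f` against the
character then produces `h`. -/
theorem convolution_invFourier {f g h : (Fin n → ℚ_[p]) → ℂ}
    (hf : Integrable f (haar p n)) (hg : Integrable g (haar p n))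
    (hfh : ∀ ξ, ∫ y, f y * stdChar (-(y ⬝ᵥ ξ)) ∂(haar p n) = h ξ) :
    convolution f (invFourier g) (ContinuousLinearMap.mul ℂ ℂ) (haar p n) =
      invFourier fun ξ => h ξ * g ξ := by
  ext x
  have hint : Integrable (Function.uncurry fun y ξ : Fin n → ℚ_[p] =>
      f y * g ξ * stdChar ((x - y) ⬝ᵥ ξ)) ((haar p n).prod (haar p n)) := by
    refine (Integrable.mul_prod hf hg).mul_bdd (c := 1) ?_ (Eventually.of_forall fun z => by simp)
    exact (by fun_prop : Continuous fun z : (Fin n → ℚ_[p]) × (Fin n → ℚ_[p]) =>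
      stdChar ((x - z.1) ⬝ᵥ z.2)).aestronglyMeasurable
  have h1 : ∀ y, ContinuousLinearMap.mul ℂ ℂ (f y) (invFourier g (x - y)) =
      ∫ ξ, f y * g ξ * stdChar ((x - y) ⬝ᵥ ξ) ∂(haar p n) := fun y => by
    rw [ContinuousLinearMap.mul_apply', invFourier, ← integral_const_mul]
    simp_rw [mul_assoc]
  rw [convolution]
  simp_rw [h1]
  rw [integral_integral_swap hint, invFourier]
  refine integral_congr_ae (Eventually.of_forall fun ξ => ?_)
  simp only
  rw [← hfh ξ, ← integral_mul_const, ← integral_mul_const]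
  refine integral_congr_ae (Eventually.of_forall fun y => ?_)
  simp only
  rw [sub_dotProduct, sub_eq_add_neg, stdChar_add]
  ring

end Convolution

/-! ### Test functions and approximate identities -/

section Distributions

theorem integrable_mul_bruhatSchwartz {f : (Fin n → ℚ_[p]) → ℂ} (hf : Integrable f (haar p n))
    (φ : BruhatSchwartz p n) : Integrable (fun x => f x * φ.1 x) (haar p n) := by
  obtain ⟨C, hC⟩ := φ.2.2.exists_bound_of_continuous φ.2.1.continuous
  exact hf.mul_bdd φ.2.1.continuous.aestronglyMeasurable (Eventually.of_forall hC)

/-- The distribution given by an integrable function. -/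
def Distribution.ofIntegrable (f : (Fin n → ℚ_[p]) → ℂ) (hf : Integrable f (haar p n)) :
    Distribution p n where
  toFun := fun φ => ∫ x, f x * φ.1 x ∂(haar p n)
  map_add' := fun φ ψ => by
    rw [← integral_add (integrable_mul_bruhatSchwartz hf φ) (integrable_mul_bruhatSchwartz hf ψ)]
    simp [mul_add]
  map_smul' := fun c φ => by
    rw [RingHom.id_apply, smul_eq_mul, ← integral_const_mul]
    simp [mul_left_comm]

open scoped ComplexOrder

/-- The difference `φ - φ 0` vanishes on the ball and is at most `2C` outside, where the mass of `f`
is one minus the mass inside. -/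
theorem norm_integral_mul_sub_le {f : (Fin n → ℚ_[p]) → ℂ} (hf : Integrable f (haar p n))
    (hpos : ∀ x, 0 ≤ f x) (hone : ∫ x, f x ∂(haar p n) = 1) {φ : (Fin n → ℚ_[p]) → ℂ}
    (hφ : Continuous φ) {C : ℝ} (hC : ∀ x, ‖φ x‖ ≤ C) {r : ℝ}
    (hr : ∀ x ∈ Metric.closedBall 0 r, φ x = φ 0) :
    ‖(∫ x, f x * φ x ∂(haar p n)) - φ 0‖ ≤
      2 * C * (1 - (∫ x in Metric.closedBall 0 r, f x ∂(haar p n)).re) := by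
  set B := Metric.closedBall (0 : Fin n → ℚ_[p]) r
  have hB : MeasurableSet B := Metric.isClosed_closedBall.measurableSet
  have hfφ : Integrable (fun x => f x * φ x) (haar p n) :=
    hf.mul_bdd hφ.aestronglyMeasurable (Eventually.of_forall hC)
  have hnorm : ∀ x, ‖f x‖ = (f x).re := fun x => by
    rw [← Complex.ofReal_inj, ← Complex.eq_coe_norm_of_nonneg (hpos x)]
    exact Complex.ext rfl (by simpa using (Complex.nonneg_iff.1 (hpos x)).2.symm)
  have hsub : (∫ x, f x * φ x ∂(haar p n)) - φ 0 =
      ∫ x, f x * (φ x - φ 0) ∂(haar p n) := by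
    simp_rw [mul_sub]
    rw [integral_sub hfφ (hf.mul_const _), integral_mul_const, hone, one_mul]
  have hcompl : ∫ x in Bᶜ, (f x).re ∂(haar p n) =
      1 - (∫ x in B, f x ∂(haar p n)).re := by
    have h1 : ∫ x in Bᶜ, (f x).re ∂(haar p n) = (∫ x in Bᶜ, f x ∂(haar p n)).re :=
      integral_re hf.integrableOn
    have h2 := integral_add_compl hB hf
    rw [h1, eq_sub_iff_add_eq', ← Complex.add_re, h2, hone, Complex.one_re]
  rw [hsub, ← hcompl, ← integral_const_mul, ← integral_indicator hB.compl]
  refine norm_integral_le_of_norm_le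
    (((hf.re.const_mul (2 * C)).indicator hB.compl)) (Eventually.of_forall fun x => ?_)
  by_cases hx : x ∈ B
  · simp [hr x hx, hx]
  · rw [Set.indicator_of_mem (by simpa using hx), norm_mul, mul_comm, hnorm]
    refine mul_le_mul_of_nonneg_right ?_ (hnorm x ▸ norm_nonneg _)
    linarith [norm_sub_le (φ x) (φ 0), hC x, hC 0]

end Distributions

/-! ### Concentration of mass as `t → 0⁺` -/

section HeatKernel

variable {w : (Fin n → ℚ_[p]) → ℝ}

/-- The mass in a ball equals the average of `e^(-κtA_w)` over the dual ball. That function is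
bounded by `1` and tends pointwise to `1`, so dominated convergence applies. -/
theorem tendsto_setIntegral_heatKernel
    (hJ : ∀ N, Integrable (truncatedInverse w N) (haar p n))
    (hw : ∀ y, 0 ≤ w y) {κ : ℝ} (hκ : 0 ≤ κ)
    (he : ∀ t : ℝ, 0 < t → Integrable (expSymbol w κ t) (haar p n)) (M : ℤ) :
    Tendsto (fun t => ∫ x in Metric.closedBall 0 ((p : ℝ) ^ M), heatKernel w κ t x ∂(haar p n))
      (𝓝[>] 0) (𝓝 1) := by
  have hp := prime_pos (p := p)
  have hfin : IsFiniteMeasure ((haar p n).restrict (Metric.closedBall 0 ((p : ℝ) ^ (-M)))) :=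
    ⟨by rw [Measure.restrict_apply_univ]; exact measure_closedBall_lt_top⟩
  have hlim : Tendsto (fun t => ∫ η in Metric.closedBall 0 ((p : ℝ) ^ (-M)),
      expSymbol w κ t η ∂(haar p n)) (𝓝[>] 0)
      (𝓝 (∫ _ in Metric.closedBall (0 : Fin n → ℚ_[p]) ((p : ℝ) ^ (-M)), 1 ∂(haar p n))) := by
    refine tendsto_integral_filter_of_dominated_convergence (fun _ => 1)
      (Eventually.of_forall fun t => (continuous_expSymbol hJ κ t).aestronglyMeasurable) ?_
      (integrable_const _) (Eventually.of_forall fun ξ => ?_)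
    · filter_upwards [self_mem_nhdsWithin] with t ht
      exact Eventually.of_forall (norm_expSymbol_le_one hJ hw hκ (le_of_lt ht))
    · have hc : Continuous fun t : ℝ => expSymbol w κ t ξ := by unfold expSymbol; fun_prop
      have := hc.tendsto 0
      rw [show expSymbol w κ 0 ξ = 1 by simp [expSymbol]] at this
      exact this.mono_left nhdsWithin_le_nhds
  have h1 : (((p : ℝ) ^ M) ^ n : ℂ) *
      ∫ _ in Metric.closedBall (0 : Fin n → ℚ_[p]) ((p : ℝ) ^ (-M)), 1 ∂(haar p n) = 1 := by
    rw [setIntegral_const, measureReal_closedBall, Complex.real_smul, mul_one]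
    have : ((p : ℝ) ^ M) ^ n * ((p : ℝ) ^ (-M)) ^ n = 1 := by
      rw [← mul_pow, ← zpow_add₀ hp.ne']
      simp
    exact_mod_cast this
  have h2 := hlim.const_mul (((p : ℝ) ^ M) ^ n : ℂ)
  rw [h1] at h2
  refine h2.congr' ?_
  filter_upwards [self_mem_nhdsWithin] with t ht
  rw [← setIntegral_invFourier_mul_stdChar (he t ht) 0 M]
  simp [heatKernel]

theorem exists_closedBall_eq {φ : (Fin n → ℚ_[p]) → ℂ} (hφ : IsLocallyConstant φ) :
    ∃ M : ℤ, ∀ x ∈ Metric.closedBall 0 ((p : ℝ) ^ M), φ x = φ 0 := by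
  obtain ⟨ε, hε, h⟩ := Metric.eventually_nhds_iff_ball.1 (hφ.eventually_eq 0)
  obtain ⟨N, hN⟩ := exists_pow_lt_of_lt_one hε (inv_lt_one_of_one_lt₀ (one_lt_prime (p := p)))
  refine ⟨-N, fun x hx => h x (lt_of_le_of_lt (Metric.mem_closedBall.1 hx) ?_)⟩
  rwa [zpow_neg, zpow_natCast, ← inv_pow]

end HeatKernel

end PadicHeat

end

/-! ### The main theorem -/

theorem theorem1 {p : ℕ} [Fact p.Prime] {n : ℕ}
    (w : (Fin n → ℚ_[p]) → ℝ)
    (hw_nonneg : ∀ y, 0 ≤ w y)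
    (hw_radial : ∀ x y, ‖x‖ = ‖y‖ → w x = w y)
    (hw_cont : Continuous w)
    (hw_zero : ∀ y, w y = 0 ↔ y = 0)
    (C₀ C₁ α₁ α₂ α₃ : ℝ) (hC₀ : 0 < C₀) (hC₁ : 0 < C₁)
    (hα₁ : (n : ℝ) < α₁) (hα₂ : (n : ℝ) < α₂) (hα₃ : 0 ≤ α₃)
    (hw_bounds : ∀ y, C₀ * ‖y‖ ^ α₁ ≤ w y ∧
      w y ≤ C₁ * ‖y‖ ^ α₂ * Real.exp (α₃ * ‖y‖))
    (κ : ℝ) (hκ : 0 < κ) :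
    -- the integrals defining `A_w` and `Z` converge absolutely
    (∀ ξ, Integrable (PadicHeat.symbolIntegrand w ξ) (PadicHeat.haar p n)) ∧
    (∀ t : ℝ, 0 < t → Integrable (PadicHeat.expSymbol w κ t) (PadicHeat.haar p n)) ∧
    -- (i) `Z` is real and nonnegative
    (∀ t : ℝ, 0 < t → ∀ x,
      (PadicHeat.heatKernel w κ t x).im = 0 ∧ 0 ≤ (PadicHeat.heatKernel w κ t x).re) ∧
    -- (ii) `Z_t` has integral one
    (∀ t : ℝ, 0 < t → ∫ x, PadicHeat.heatKernel w κ t x ∂(PadicHeat.haar p n) = 1) ∧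
    -- (iii) `Z_t` is continuous and lies in `L¹ ∩ L²`
    (∀ t : ℝ, 0 < t → Continuous (PadicHeat.heatKernel w κ t) ∧
      MemLp (PadicHeat.heatKernel w κ t) 1 (PadicHeat.haar p n) ∧
      MemLp (PadicHeat.heatKernel w κ t) 2 (PadicHeat.haar p n)) ∧
    -- (iv) the semigroup law
    (∀ t t' : ℝ, 0 < t → 0 < t' →
      ConvolutionExists (PadicHeat.heatKernel w κ t) (PadicHeat.heatKernel w κ t')
        (ContinuousLinearMap.mul ℂ ℂ) (PadicHeat.haar p n) ∧
      convolution (PadicHeat.heatKernel w κ t) (PadicHeat.heatKernel w κ t')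
        (ContinuousLinearMap.mul ℂ ℂ) (PadicHeat.haar p n) =
          PadicHeat.heatKernel w κ (t + t')) ∧
    -- (v) `Z_t → δ` in `S'` as `t → 0⁺`
    (∃ T : ℝ → PadicHeat.Distribution p n,
      (∀ t : ℝ, 0 < t → PadicHeat.IsGivenBy (T t) (PadicHeat.heatKernel w κ t)) ∧
      PadicHeat.TendstoDistribution T (𝓝[>] 0) (PadicHeat.dirac p n)) := by
  have hJ := PadicHeat.integrable_truncatedInverse hw_cont hC₀ hα₁ fun y => (hw_bounds y).1
  obtain ⟨c, hc, hlow⟩ := PadicHeat.exists_rpow_le_re_symbol hJ hw_nonneg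
    (fun y => (hw_zero y).1) hC₁ hα₂ hα₃ fun y => (hw_bounds y).2
  have he : ∀ t : ℝ, 0 < t → Integrable (PadicHeat.expSymbol w κ t) (PadicHeat.haar p n) :=
    fun t ht => PadicHeat.integrable_expSymbol hJ hw_nonneg hc (sub_pos.2 hα₂) hlow hκ ht
  have hec := PadicHeat.continuous_expSymbol hJ κ
  open scoped ComplexOrder in
  have hpos : ∀ t : ℝ, 0 < t → ∀ x, 0 ≤ PadicHeat.heatKernel w κ t x := fun t ht =>
    PadicHeat.heatKernel_nonneg hJ hw_nonneg hκ.le ht.le (he t ht)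
  have hZ : ∀ t : ℝ, 0 < t → Integrable (PadicHeat.heatKernel w κ t) (PadicHeat.haar p n) :=
    fun t ht => PadicHeat.integrable_invFourier (he t ht) (hec t) (hpos t ht)
  have hfourier : ∀ t : ℝ, 0 < t → ∀ ξ, ∫ y, PadicHeat.heatKernel w κ t y *
      PadicHeat.stdChar (-(y ⬝ᵥ ξ)) ∂(PadicHeat.haar p n) = PadicHeat.expSymbol w κ t ξ :=
    fun t ht => PadicHeat.integral_invFourier_mul_stdChar (he t ht) (hec t) (hpos t ht)
  have hone : ∀ t : ℝ, 0 < t →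
      ∫ x, PadicHeat.heatKernel w κ t x ∂(PadicHeat.haar p n) = 1 := fun t ht => by
    simpa [PadicHeat.expSymbol_zero_right] using hfourier t ht 0
  have hcont : ∀ t : ℝ, 0 < t → Continuous (PadicHeat.heatKernel w κ t) := fun t ht =>
    PadicHeat.continuous_invFourier (he t ht)
  refine ⟨PadicHeat.integrable_symbolIntegrand hJ, he, fun t ht x => ?_, hone,
    fun t ht => ⟨hcont t ht, memLp_one_iff_integrable.2 (hZ t ht), ?_⟩, fun t t' ht ht' => ⟨?_, ?_⟩,
    -- The value at `t ≤ 0` is irrelevant to the limit along `𝓝[>] 0`.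
    fun t => if ht : 0 < t then PadicHeat.Distribution.ofIntegrable _ (hZ t ht) else 0,
    fun t ht => ⟨(hZ t ht).locallyIntegrable, fun φ => ?_⟩, fun φ => ?_⟩
  · exact ⟨(Complex.nonneg_iff.1 (hpos t ht x)).2.symm, (Complex.nonneg_iff.1 (hpos t ht x)).1⟩
  -- A bounded integrable function is square integrable; the bound is the `L¹` norm of `e^(-κtA_w)`.
  · refine (memLp_two_iff_integrable_sq_norm (hcont t ht).aestronglyMeasurable).2 ?_
    simp_rw [sq]
    exact (hZ t ht).norm.mul_bdd (hcont t ht).norm.aestronglyMeasurable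
      (Eventually.of_forall fun x => by
        rw [norm_norm]
        exact PadicHeat.norm_invFourier_le (PadicHeat.expSymbol w κ t) x)
  · exact PadicHeat.convolutionExists_invFourier (hZ t ht) (he t' ht')
  · refine (PadicHeat.convolution_invFourier (hZ t ht) (he t' ht') (hfourier t ht)).trans ?_
    simp_rw [← PadicHeat.expSymbol_add]
    rfl
  · beta_reduce
    rw [dif_pos ht]
    rfl
  · obtain ⟨C, hC⟩ := φ.2.2.exists_bound_of_continuous φ.2.1.continuous
    obtain ⟨M, hM⟩ := PadicHeat.exists_closedBall_eq φ.2.1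
    have hlim := PadicHeat.tendsto_setIntegral_heatKernel hJ hw_nonneg hκ.le he M
    have hlim' := (((Complex.continuous_re.tendsto 1).comp hlim).const_sub 1).const_mul (2 * C)
    rw [Complex.one_re, sub_self, mul_zero] at hlim'
    rw [tendsto_iff_norm_sub_tendsto_zero]
    refine squeeze_zero' (Eventually.of_forall fun t => norm_nonneg _) ?_ hlim'
    filter_upwards [self_mem_nhdsWithin] with t (ht : 0 < t)
    rw [dif_pos ht]
    exact PadicHeat.norm_integral_mul_sub_le (hZ t ht) (hpos t ht) (hone t ht)
      φ.2.1.continuous hC hM
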